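/- All graphs are finite and simple. For graphs $X$ and $Y$ with the same number of vertices, let $\mathsf{FS}(X,Y)$ be the graph whose vertices are the bijections $V(X)\to V(Y)$, where $\sigma$ and $\sigma'$ are adjacent if and only if there is an edge $\{a,b\}\in E(X)$ such that $\{\sigma(a),\sigma(b)\}\in E(Y)$, $\sigma(a)=\sigma'(b)$, $\sigma(b)=\sigma'(a)$, and $\sigma(c)=\sigma'(c)$ for all $c\in V(X)\setminus\{a,b\}$. Let $\mathsf{Star}_k$ be the star graph on $k$ vertices (one center adjacent to $k-1$ leaves). A graph is biconnected if it is connected and deleting any one of its vertices does not disconnect it (the graph with no vertices is not regarded as disconnected here). Theorem. Let $k\geq 1$, and let $Y$ be an $n$-vertex graph such that every $k$-vertex induced subgraph of $Y$ is connected. If $n\geq 2k-1$, then there exists a $k$-vertex induced subgraph $Y_0$ of $Y$ such that $\mathsf{FS}(\mathsf{Star}_k,Y_0)$ is connected. Moreover, $Y_0$ can be chosen so that, in addition, it is biconnected and, if $k\geq 3$, contains a triangle. -/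

import Mathlib

namespace SimpleGraph

/-- The friends-and-strangers graph `FS(X, Y)`: its vertices are the bijections from the vertex
set of `X` to the vertex set of `Y`, and `σ`, `τ` are adjacent iff there is an edge `{a, b}` of `X`
such that `{σ a, σ b}` is an edge of `Y`, and `τ` arises from `σ` by exchanging the values
at `a` and `b`. -/
def friendsAndStrangers {V W : Type*} (X : SimpleGraph V) (Y : SimpleGraph W) :
    SimpleGraph (V ≃ W) where
  Adj σ τ := ∃ a b : V, X.Adj a b ∧ Y.Adj (σ a) (σ b) ∧ σ a = τ b ∧ σ b = τ a ∧
    ∀ c : V, c ≠ a → c ≠ b → σ c = τ c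
  symm := ⟨by
    rintro σ τ ⟨a, b, hX, hY, h1, h2, h3⟩
    refine ⟨a, b, hX, ?_, h2.symm, h1.symm, fun c ha hb => (h3 c ha hb).symm⟩
    rw [← h1, ← h2]
    exact hY.symm⟩
  loopless := ⟨by
    rintro σ ⟨a, b, hX, -, h1, -, -⟩
    exact hX.ne (σ.injective h1)⟩

/-- The star graph with `k ≥ 1` vertices: one center joined to the `k - 1` other vertices. -/
def starOn (k : ℕ) [NeZero k] : SimpleGraph (Fin k) :=
  starGraph (0 : Fin k)

/-- `v` is a cut vertex of `G` if `G` is connected and deleting `v` from `G` leaves a disconnected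
graph, i.e. one that has two vertices not joined by a walk. -/
def IsCutVertex {V : Type*} (G : SimpleGraph V) (v : V) : Prop :=
  G.Connected ∧ ¬ (G.induce {v}ᶜ).Preconnected

/-- A graph is biconnected if it is connected and has no cut vertices. -/
def IsBiconnected {V : Type*} (G : SimpleGraph V) : Prop :=
  G.Connected ∧ ∀ v : V, ¬ G.IsCutVertex v

end SimpleGraph

namespace SimpleGraph

open Equiv Finset

variable {V : Type*} {Y : SimpleGraph V} {S T : Finset V} {p u v a b : V} {g h : Perm V}

/-! In a star the centre acts as a blank sliding along edges of `Y`, so `FS(Star_k, Y₀)` is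
connected once a blank started anywhere in `Y₀` can realise every permutation of it. This property
survives adding a vertex with two neighbours in the set (`IsFullyAchievable.insert`), as does
biconnectedness. So grow the set from an edge; the first addition makes a triangle. A suitable
vertex exists below size `k` by double counting (`exists_notMem_adj_adj`), since each vertex has few
non-neighbours. -/

lemma isBiconnected_induce (hconn : (Y.induce (S : Set V)).Connected)
    (hS : ∀ x, (Y.induce ((S : Set V) \ {x})).Preconnected) :
    (Y.induce (S : Set V)).IsBiconnected := by
  refine ⟨hconn, fun v hv => hv.2 ?_⟩
  let f : Y.induce ((S : Set V) \ {(v : V)}) →g (Y.induce (S : Set V)).induce {v}ᶜ :=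
    { toFun := fun x => ⟨⟨x, x.2.1⟩, fun e => x.2.2 (congrArg Subtype.val e)⟩
      map_rel' := fun h => h }
  refine (hS v).map f fun y => ⟨⟨y, y.1.2, fun e => y.2 (Subtype.ext e)⟩, rfl⟩

/-- Otherwise `v`, which counts among its own non-neighbours, would be isolated in a `k`-set. -/
lemma card_filter_not_adj_lt [Fintype V] [DecidableRel Y.Adj] {k : ℕ} (hk : 2 ≤ k)
    (hconn : ∀ S : Finset V, S.card = k → (Y.induce (S : Set V)).Connected) (v : V) :
    #{w | ¬ Y.Adj v w} < k := by
  by_contra! hcard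
  obtain ⟨T, hvT, hT, hTk⟩ := exists_subsuperset_card_eq (s := {v})
    (by simp : {v} ⊆ ({w | ¬ Y.Adj v w} : Finset V)) (by simp; omega) hcard
  have : Nontrivial (T : Set V) := by
    rw [Set.nontrivial_coe_sort, nontrivial_coe, ← one_lt_card_iff_nontrivial]
    omega
  obtain ⟨w, hw⟩ := (hconn T hTk).preconnected.exists_adj_of_nontrivial
    ⟨v, hvT (mem_singleton_self v)⟩
  exact (mem_filter.mp (hT w.2)).2 hw

/-! ### Permutations realised by a moving blank -/

variable [DecidableEq V]

/-- `Y.IsAchievable S p g` means that a blank starting at `p` can walk inside `S` along edges of `Y`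
so that the resulting sequence of swaps composes to the permutation `g`. -/
inductive IsAchievable (Y : SimpleGraph V) (S : Finset V) : V → Perm V → Prop
  | one (p : V) : IsAchievable Y S p 1
  | step {p q : V} {g : Perm V} (hp : p ∈ S) (hq : q ∈ S) (hpq : Y.Adj p q)
      (hg : IsAchievable Y S q g) : IsAchievable Y S p (g * swap p q)

/-- Every permutation supported in `S` can be achieved by moving a blank that starts at any point
of `S`. -/
def IsFullyAchievable (Y : SimpleGraph V) (S : Finset V) : Prop :=
  ∀ p ∈ S, ∀ g : Perm V, (∀ x ∉ S, g x = x) → Y.IsAchievable S p g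

lemma IsAchievable.mono (hST : S ⊆ T) (hg : Y.IsAchievable S p g) : Y.IsAchievable T p g := by
  induction hg with
  | one p => exact .one p
  | step hp hq hpq _ ih => exact .step (hST hp) (hST hq) hpq ih

/-- Walks concatenate because the blank ends at `g p`. -/
lemma IsAchievable.mul (hg : Y.IsAchievable S p g) (hh : Y.IsAchievable S (g p) h) :
    Y.IsAchievable S p (h * g) := by
  induction hg with
  | one p => simpa using hh
  | step hp hq hpq _ ih =>
    rw [← mul_assoc]
    exact .step hp hq hpq (ih (by simpa using hh))

lemma isAchievable_swap (hu : u ∈ S) (hv : v ∈ S) (huv : Y.Adj u v) :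
    Y.IsAchievable S u (swap u v) := by
  simpa using IsAchievable.step hu hv huv (.one v)

lemma isFullyAchievable_singleton (v : V) : Y.IsFullyAchievable {v} := by
  intro p _ g hg
  have : g = 1 := by
    ext x
    by_cases hx : x = v
    · subst hx
      by_contra hne
      have := g.injective (hg (g x) (by simpa using hne))
      exact hne this
    · exact hg x (by simpa using hx)
  exact this ▸ .one p

lemma isFullyAchievable_pair (huv : Y.Adj u v) : Y.IsFullyAchievable {u, v} := by
  have key : ∀ g : Perm V, (∀ x ∉ ({u, v} : Finset V), g x = x) → g = 1 ∨ g = swap u v := by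
    intro g hg
    have hne := huv.ne
    have hmem : ∀ x ∈ ({u, v} : Finset V), g x ∈ ({u, v} : Finset V) := by
      intro x hx
      by_contra hgx
      exact hgx (by rwa [g.injective (hg _ hgx)])
    have hu := hmem u (by simp)
    have hv := hmem v (by simp)
    simp only [mem_insert, mem_singleton] at hu hv
    have hinj : g u ≠ g v := fun e => hne (g.injective e)
    rcases hu with hu | hu
    · left
      ext x
      by_cases hx : x ∈ ({u, v} : Finset V)
      · simp only [mem_insert, mem_singleton] at hx
        rcases hx with rfl | rfl
        · exact hu
        · rcases hv with hv | hv
          · exact absurd (hu.trans hv.symm) hinj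
          · exact hv
      · exact hg x hx
    · right
      ext x
      by_cases hx : x ∈ ({u, v} : Finset V)
      · simp only [mem_insert, mem_singleton] at hx
        rcases hx with rfl | rfl
        · simpa using hu
        · rcases hv with hv | hv
          · simpa using hv
          · exact absurd (hu.trans hv.symm) hinj
      · rw [hg x hx]
        simp only [mem_insert, mem_singleton, not_or] at hx
        rw [swap_apply_of_ne_of_ne hx.1 hx.2]
  intro p hp g hg
  rcases key g hg with rfl | rfl
  · exact .one p
  · simp only [mem_insert, mem_singleton] at hp
    rcases hp with rfl | rfl
    · exact isAchievable_swap (by simp) (by simp) huv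
    · rw [swap_comm]
      exact isAchievable_swap (by simp) (by simp) huv.symm

lemma exists_perm_of_ne {p t a b : V} (hp : p ∈ S) (ht : t ∈ S) (ha : a ∈ S) (hb : b ∈ S)
    (hpt : p ≠ t) (hab : a ≠ b) :
    ∃ h : Perm V, (∀ x ∉ S, h x = x) ∧ h p = b ∧ h t = a := by
  have hs : ∀ x ∈ S, ∀ y ∈ S, ∀ z ∉ S, swap x y z = z := fun x hx y hy z hz =>
    swap_apply_of_ne_of_ne (fun e => hz (e ▸ hx)) (fun e => hz (e ▸ hy))
  have ht' : swap p b t ∈ S := by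
    by_cases h1 : t = b
    · simpa [h1] using hp
    · rwa [swap_apply_of_ne_of_ne hpt.symm h1]
  -- Send `p` to `b`, then the current image of `t` to `a`; the second swap avoids `b`.
  refine ⟨swap (swap p b t) a * swap p b, fun x hx => ?_, ?_, ?_⟩
  · rw [Perm.mul_apply, hs p hp b hb x hx, hs _ ht' a ha x hx]
  · rw [Perm.mul_apply, swap_apply_left, swap_apply_of_ne_of_ne _ hab.symm]
    intro e
    exact hpt ((swap p b).injective (by rw [← e, swap_apply_left]))
  · simp

/-- Let `t` be the position whose content must end at `v`. Inside `S`, bring the blank to `b` and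
that content to `a`; the blank's walk `b, v, a` pushes the content into `v`. What remains fixes `v`,
so it is done in `S`. -/
lemma IsFullyAchievable.insert (hS : Y.IsFullyAchievable S) (hv : v ∉ S) (ha : a ∈ S) (hb : b ∈ S)
    (hab : a ≠ b) (hva : Y.Adj v a) (hvb : Y.Adj v b) :
    Y.IsFullyAchievable (insert v S) := by
  have hsub : S ⊆ Insert.insert v S := subset_insert v S
  have hv' : v ∈ Insert.insert v S := mem_insert_self v S
  have hav : a ≠ v := hva.ne.symm
  have hbv : b ≠ v := hvb.ne.symm
  have inner : ∀ p ∈ S, ∀ g : Perm V, (∀ x ∉ Insert.insert v S, g x = x) → g p ≠ v →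
      Y.IsAchievable (Insert.insert v S) p g := by
    intro p hp g hg hgp
    by_cases hgv : g v = v
    · refine (hS p hp g fun x hx => ?_).mono hsub
      by_cases hxv : x = v
      · rw [hxv, hgv]
      · exact hg x (by simp [hx, hxv])
    · obtain ⟨t, ht⟩ := g.surjective v
      have htv : t ≠ v := by rintro rfl; exact hgv ht
      have htS : t ∈ S := by
        by_contra hn
        exact htv ((hg t (by simp [hn, htv])).symm.trans ht)
      obtain ⟨h, hh, hhp, hht⟩ := exists_perm_of_ne hp htS ha hb
        (by rintro rfl; exact hgp ht) hab
      set c : Perm V := swap v a * swap b v with hc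
      have hcb : c b = a := by simp [hc]
      have hca : c a = v := by simp [hc, swap_apply_of_ne_of_ne hab hav]
      have hcx : ∀ x ∉ Insert.insert v S, c x = x := by
        intro x hx
        simp only [mem_insert, not_or] at hx
        have hxa : x ≠ a := by rintro rfl; exact hx.2 ha
        have hxb : x ≠ b := by rintro rfl; exact hx.2 hb
        simp [hc, swap_apply_of_ne_of_ne hxb hx.1, swap_apply_of_ne_of_ne hx.1 hxa]
      have hach : Y.IsAchievable (Insert.insert v S) b c :=
        .step (hsub hb) hv' hvb.symm (isAchievable_swap hv' (hsub ha) hva)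
      have hg' : ∀ x ∉ S, (g * h⁻¹ * c⁻¹) x = x := by
        intro x hx
        by_cases hxv : x = v
        · subst hxv
          have e1 : c⁻¹ x = a := by rw [Perm.inv_eq_iff_eq, hca]
          have e2 : h⁻¹ a = t := by rw [Perm.inv_eq_iff_eq, hht]
          simp only [Perm.mul_apply, e1, e2, ht]
        · have hx' : x ∉ Insert.insert v S := by simp [hx, hxv]
          have e1 : c⁻¹ x = x := by rw [Perm.inv_eq_iff_eq, hcx x hx']
          have e2 : h⁻¹ x = x := by rw [Perm.inv_eq_iff_eq, hh x hx]
          simp only [Perm.mul_apply, e1, e2, hg x hx']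
      have h1 := ((hS p hp h hh).mono hsub).mul (hhp.symm ▸ hach)
      have h2 := h1.mul (h := g * h⁻¹ * c⁻¹)
        (by simpa [hhp, hcb] using (hS a ha _ hg').mono hsub)
      simpa [mul_assoc] using h2
  have supp : ∀ x ∉ Insert.insert v S, swap v a x = x := by
    intro x hx
    simp only [mem_insert, not_or] at hx
    exact swap_apply_of_ne_of_ne hx.1 (by rintro rfl; exact hx.2 ha)
  have outer : ∀ p ∈ S, ∀ g : Perm V, (∀ x ∉ Insert.insert v S, g x = x) →
      Y.IsAchievable (Insert.insert v S) p g := by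
    intro p hp g hg
    -- If the blank must finish at `v`, finish at `a` and then step to `v`.
    by_cases hgp : g p = v
    · have h1 := inner p hp (swap a v * g)
        (fun x hx => by rw [Perm.mul_apply, hg x hx, swap_comm, supp x hx])
        (by simp [hgp, hav])
      have h2 := h1.mul (h := swap a v)
        (by simpa [hgp] using isAchievable_swap (hsub ha) hv' hva.symm)
      simpa [← mul_assoc] using h2
    · exact inner p hp g hg hgp
  intro p hp g hg
  rcases mem_insert.mp hp with rfl | hp
  · have h1 := outer a ha (g * swap p a)
      (fun x hx => by rw [Perm.mul_apply, supp x hx, hg x hx])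
    simpa [mul_assoc] using IsAchievable.step hv' (hsub ha) hva h1
  · exact outer p hp g hg

/-! ### From blank walks to `FS`; biconnectedness -/

lemma IsAchievable.reachable {k : ℕ} [NeZero k] (hg : Y.IsAchievable S p g) :
    ∀ σ τ : Fin k ≃ (S : Set V), (σ 0 : V) = p → (∀ i, (τ i : V) = g (σ i)) →
      (friendsAndStrangers (starOn k) (Y.induce (S : Set V))).Reachable σ τ := by
  induction hg with
  | one p =>
    intro σ τ _ h
    have : σ = τ := by
      ext i
      simp [h i]
    exact this ▸ .refl σ
  | @step p q g hp hq hpq _ ih =>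
    intro σ τ hσ h
    have hσ0 : σ 0 = ⟨p, hp⟩ := Subtype.ext hσ
    have hne : (⟨p, hp⟩ : (S : Set V)) ≠ ⟨q, hq⟩ := fun e => hpq.ne (congrArg Subtype.val e)
    let σ' : Fin k ≃ (S : Set V) := σ.trans (swap ⟨p, hp⟩ ⟨q, hq⟩)
    have hσ' : ∀ i, (σ' i : V) = swap p q (σ i) := by
      intro i
      simp only [σ', Equiv.trans_apply, swap_apply_def, Subtype.ext_iff]
      split_ifs <;> rfl
    have hadj : (friendsAndStrangers (starOn k) (Y.induce (S : Set V))).Adj σ σ' := by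
      refine ⟨0, σ.symm ⟨q, hq⟩, ?_, ?_, ?_, ?_, ?_⟩
      · rw [starOn, starGraph_adj]
        refine ⟨fun e => hne ?_, .inl rfl⟩
        rw [← hσ0, e, apply_symm_apply]
      · simpa [hσ0] using hpq
      · simp [σ', hσ0]
      · simp [σ', hσ0]
      · intro c hc0 hcq
        have h1 : σ c ≠ ⟨p, hp⟩ := fun e => hc0 (σ.injective (e.trans hσ0.symm))
        have h2 : σ c ≠ ⟨q, hq⟩ := fun e => hcq (by rw [← e, symm_apply_apply])
        simp only [σ', Equiv.trans_apply]
        rw [swap_apply_of_ne_of_ne h1 h2]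
    refine hadj.reachable.trans (ih σ' τ ?_ fun i => ?_)
    · rw [hσ', hσ, swap_apply_left]
    · rw [h i, hσ' i, Perm.mul_apply]

lemma IsFullyAchievable.connected_friendsAndStrangers {k : ℕ} [NeZero k]
    (hS : Y.IsFullyAchievable S) (hk : S.card = k) :
    (friendsAndStrangers (starOn k) (Y.induce (S : Set V))).Connected := by
  have : Nonempty (Fin k ≃ (S : Set V)) := ⟨(S.equivFinOfCardEq hk).symm⟩
  refine ⟨fun σ τ => ?_⟩
  let e : Perm (S : Set V) := σ.symm.trans τ
  refine (hS (σ 0) (σ 0).2 (Perm.ofSubtype e) fun x hx => ?_).reachable σ τ rfl fun i => ?_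
  · exact Perm.ofSubtype_apply_of_not_mem e hx
  · rw [Perm.ofSubtype_apply_coe]
    simp [e]

lemma preconnected_induce_insert_diff (hS : ∀ x, (Y.induce ((S : Set V) \ {x})).Preconnected)
    (hv : v ∉ S) (ha : a ∈ S) (hb : b ∈ S) (hab : a ≠ b) (hva : Y.Adj v a) (hvb : Y.Adj v b)
    (x : V) : (Y.induce (((insert v S : Finset V) : Set V) \ {x})).Preconnected := by
  by_cases hx : x = v
  · subst hx
    have : ((insert x S : Finset V) : Set V) \ {x} = (S : Set V) \ {x} := by
      ext y; simp
    exact this ▸ hS x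
  -- Deleting `x` spares one of the two neighbours of `v`.
  · obtain ⟨c, hc, hcx, hvc⟩ : ∃ c ∈ S, c ≠ x ∧ Y.Adj v c := by
      by_cases h : a = x
      · exact ⟨b, hb, fun e => hab (h.trans e.symm), hvb⟩
      · exact ⟨a, ha, h, hva⟩
    have : ((insert v S : Finset V) : Set V) \ {x} = ((S : Set V) \ {x}) ∪ {v, c} := by
      ext y
      simp only [coe_insert, Set.mem_sdiff, Set.mem_insert_iff, mem_coe, Set.mem_singleton_iff,
        Set.mem_union]
      constructor
      · rintro ⟨rfl | h, h'⟩ <;> simp_all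
      · rintro (⟨h, h'⟩ | rfl | rfl)
        · exact ⟨.inr h, h'⟩
        · exact ⟨.inl rfl, fun e => hx e.symm⟩
        · exact ⟨.inr hc, hcx⟩
    rw [this]
    exact (induce_union_connected (hS x) (induce_pair_connected_of_adj hvc).preconnected
      ⟨c, ⟨hc, hcx⟩, by simp⟩).preconnected

/-! ### Growing the set by counting -/

section Counting

variable [Fintype V] {k : ℕ}

lemma exists_notMem_adj_adj (hk : 2 * k - 1 ≤ Fintype.card V)
    (hconn : ∀ S : Finset V, S.card = k → (Y.induce (S : Set V)).Connected)
    (hS : 2 ≤ #S) (hSk : #S < k) :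
    ∃ v ∉ S, ∃ a ∈ S, ∃ b ∈ S, a ≠ b ∧ Y.Adj v a ∧ Y.Adj v b := by
  classical
  by_contra! hno
  -- Count edges leaving `S`: degrees are at least `n + 1 - k`, with at most `#S - 1` neighbours
  -- inside, while each outside vertex meets at most one.
  have hle : #S * (Fintype.card V + 2 - k - #S) ≤ #Sᶜ * 1 := by
    refine card_mul_le_card_mul Y.Adj (fun s hs => ?_) fun w hw => ?_
    · have h1 := card_filter_not_adj_lt (by omega) hconn s
      have h2 : #{w | Y.Adj s w} + #{w | ¬ Y.Adj s w} = Fintype.card V :=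
        card_filter_add_card_filter_not _
      have h3 : #{w | Y.Adj s w} ≤ #(S.erase s) + #(bipartiteAbove Y.Adj Sᶜ s) := by
        refine (card_le_card fun w hw => ?_).trans (card_union_le _ _)
        have hw' : Y.Adj s w := by simpa using hw
        by_cases hwS : w ∈ S
        · exact mem_union_left _ (mem_erase.mpr ⟨hw'.ne.symm, hwS⟩)
        · exact mem_union_right _ (by simp [bipartiteAbove, hwS, hw'])
      rw [card_erase_of_mem hs] at h3
      omega
    · refine card_le_one.mpr fun a ha b hb => ?_
      simp only [bipartiteBelow, mem_filter] at ha hb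
      by_contra hab
      exact hno w (by simpa using hw) a ha.1 b hb.1 hab ha.2.symm hb.2.symm
  rw [card_compl] at hle
  obtain ⟨i, hi⟩ := Nat.exists_eq_add_of_le hS
  obtain ⟨j, hj⟩ := Nat.exists_eq_add_of_lt hSk
  obtain ⟨l, hl⟩ := Nat.exists_eq_add_of_le hk
  have e1 : Fintype.card V + 2 - k - #S = j + 2 + l := by omega
  have e2 : Fintype.card V - #S = i + 2 * j + l + 3 := by omega
  rw [e1, e2, hi] at hle
  nlinarith [Nat.zero_le (i * j), Nat.zero_le (i * l)]

lemma exists_card_eq_isFullyAchievable (hk : 2 * k - 1 ≤ Fintype.card V)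
    (hconn : ∀ S : Finset V, S.card = k → (Y.induce (S : Set V)).Connected) {m : ℕ}
    (hm : 2 ≤ m) (hmk : m ≤ k) :
    ∃ S : Finset V, #S = m ∧ Y.IsFullyAchievable S ∧
      (∀ x, (Y.induce ((S : Set V) \ {x})).Preconnected) ∧
      (∃ a ∈ S, ∃ b ∈ S, Y.Adj a b) ∧
      (3 ≤ m → ∃ a ∈ S, ∃ b ∈ S, ∃ c ∈ S, Y.Adj a b ∧ Y.Adj a c ∧ Y.Adj b c) := by
  induction m, hm using Nat.le_induction with
  | base =>
    obtain ⟨T, hT⟩ := exists_subset_card_eq (s := (univ : Finset V)) (n := k)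
      (by rw [card_univ]; omega)
    have : Nontrivial (T : Set V) := by
      rw [Set.nontrivial_coe_sort, nontrivial_coe, ← one_lt_card_iff_nontrivial]
      omega
    obtain ⟨u⟩ : Nonempty (T : Set V) := inferInstance
    obtain ⟨w, huw⟩ := (hconn T hT.2).preconnected.exists_adj_of_nontrivial u
    replace huw : Y.Adj u w := huw
    refine ⟨{(u : V), (w : V)}, card_pair huw.ne, isFullyAchievable_pair huw, fun x => ?_,
      ⟨u, by simp, w, by simp, huw⟩, by omega⟩
    by_cases hx : x = u ∨ x = w
    · have : Subsingleton ↑((({(u : V), (w : V)} : Finset V) : Set V) \ {x}) := by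
        rw [Set.subsingleton_coe]
        intro y hy z hz
        simp only [coe_insert, coe_singleton, Set.mem_sdiff, Set.mem_insert_iff,
          Set.mem_singleton_iff] at hy hz
        grind
      exact .of_subsingleton
    · have : (({(u : V), (w : V)} : Finset V) : Set V) \ {x} = {(u : V), (w : V)} := by
        ext y
        simp only [coe_insert, coe_singleton, Set.mem_sdiff, Set.mem_insert_iff,
          Set.mem_singleton_iff]
        grind
      rw [this]
      exact (induce_pair_connected_of_adj huw).preconnected
  | succ m hm ih =>
    obtain ⟨S, hSm, hS, hpre, hedge, htri⟩ := ih (by omega)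
    obtain ⟨v, hv, a, ha, b, hb, hab, hva, hvb⟩ :=
      exists_notMem_adj_adj hk hconn (S := S) (by omega) (by omega)
    refine ⟨insert v S, by rw [card_insert_of_notMem hv, hSm],
      hS.insert hv ha hb hab hva hvb, preconnected_induce_insert_diff hpre hv ha hb hab hva hvb,
      ⟨v, by simp, a, by simp [ha], hva⟩, fun _ => ?_⟩
    by_cases h3 : 3 ≤ m
    · obtain ⟨x, hx, y, hy, z, hz, h⟩ := htri h3
      exact ⟨x, by simp [hx], y, by simp [hy], z, by simp [hz], h⟩
    · obtain ⟨x, hx, y, hy, hxy⟩ := hedge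
      -- Here `m = 2`: `S` is an edge and `v` sees both ends.
      have hSxy : {x, y} = S := eq_of_subset_of_card_le (by grind) (by rw [card_pair hxy.ne]; omega)
      have habadj : Y.Adj a b := by
        rw [← hSxy] at ha hb
        simp only [mem_insert, mem_singleton] at ha hb
        rcases ha with rfl | rfl <;> rcases hb with rfl | rfl
        · exact absurd rfl hab
        · exact hxy
        · exact hxy.symm
        · exact absurd rfl hab
      exact ⟨v, by simp, a, by simp [ha], b, by simp [hb], hva, hvb, habadj⟩

end Counting

end SimpleGraph

theorem theorem1p2 {V : Type*} [Fintype V] (Y : SimpleGraph V) (n k : ℕ) [NeZero k]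
    (hcard : Fintype.card V = n) (hn : 2 * k - 1 ≤ n)
    (hconn : ∀ S : Finset V, S.card = k → (Y.induce (S : Set V)).Connected) :
    ∃ S : Finset V, S.card = k ∧
      (SimpleGraph.friendsAndStrangers (SimpleGraph.starOn k) (Y.induce (S : Set V))).Connected ∧
      (Y.induce (S : Set V)).IsBiconnected ∧
      (3 ≤ k → ∃ t : Finset (S : Set V), (Y.induce (S : Set V)).IsNClique 3 t) := by
  classical
  subst hcard
  have hk0 : k ≠ 0 := NeZero.ne k
  rcases Nat.lt_or_ge k 2 with hk | hk
  · obtain rfl : k = 1 := by omega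
    obtain ⟨v⟩ : Nonempty V := Fintype.card_pos_iff.mp (by omega)
    refine ⟨{v}, by simp,
      (SimpleGraph.isFullyAchievable_singleton v).connected_friendsAndStrangers (by simp),
      SimpleGraph.isBiconnected_induce (hconn _ (by simp)) fun x => ?_, by omega⟩
    have : Subsingleton ↑((({v} : Finset V) : Set V) \ {x}) := by
      rw [Set.subsingleton_coe]
      exact (by simp : ((({v} : Finset V) : Set V)).Subsingleton).anti Set.sdiff_subset
    exact .of_subsingleton
  · obtain ⟨S, hSk, hS, hpre, -, htri⟩ :=
      SimpleGraph.exists_card_eq_isFullyAchievable hn hconn hk le_rfl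
    refine ⟨S, hSk, hS.connected_friendsAndStrangers hSk,
      SimpleGraph.isBiconnected_induce (hconn S hSk) hpre, fun h3 => ?_⟩
    obtain ⟨a, ha, b, hb, c, hc, hab, hac, hbc⟩ := htri h3
    exact ⟨{⟨a, ha⟩, ⟨b, hb⟩, ⟨c, hc⟩}, SimpleGraph.is3Clique_triple_iff.mpr
      ⟨SimpleGraph.induce_adj.mpr hab, SimpleGraph.induce_adj.mpr hac,
        SimpleGraph.induce_adj.mpr hbc⟩⟩
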